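/- Let $B_n$ be the group of signed permutations, i.e. bijections $\pi$ of $\{-n,\dots,n\}$ with $\pi(-i)=-\pi(i)$. For $\pi\in B_n$ let $\mathrm{des}_B(\pi)=|\{i\in\{0,\dots,n-1\}:\pi(i)>\pi(i+1)\}|$, and let $\mathrm{md}_B(\pi)$ be the maximum of the drop sizes $\min\{i-\pi(i),i\}$ over the positions $i\in\{1,\dots,n\}$ with $\pi(i)<i$ (and $0$ if there are none). Put $$B_n(x)=\sum_{\pi\in B_n}x^{\mathrm{des}_B(\pi)},\qquad B_{n,k}(x)=\sum_{\pi\in B_n,\ \mathrm{md}_B(\pi)\le k}x^{\mathrm{des}_B(\pi)} .$$ (a) For all integers $n,k\ge 0$ we have $B_{n,k}(x)=\sum_{d}\gamma_k((k+1)d)\,x^d$, where the numbers $\gamma_k(j)$ (which also depend on $n$) are the coefficients of the formal Laurent series $$\sum_j\gamma_k(j)u^j=Q_k(u)\left(\frac{1-u^{k+1}}{1-u}\right)^{n-k},\qquad Q_k(u)=\sum_{j=0}^{k}B_{k-j}(u^{k+1})\,(u^{k+1}-1)^j\sum_{i=j}^{k}\binom{i}{j}u^{-i}.$$ Here $\gamma_k((k+1)d)=0$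 for every integer $d<0$. Thus the coefficients of $B_{n,k}$ are every $(k+1)$-st coefficient of $Q_k(u)(1+u+\dots+u^k)^{n-k}$. (b) More generally, let $k\ge 0$, let $K$ be a field, let $C_{0,k},\dots,C_{k,k}\in K[x]$ be arbitrary, and for $n\ge 0$ let $$C_{n+k+1,k}(x)=\sum_{i=1}^{k+1}\binom{k+1}{i}(x-1)^{i-1}C_{n+k+1-i,k}(x).$$ Then for all $n\ge 0$ we have $C_{n,k}(x)=\sum_{d}\beta_k((k+1)d)\,x^d$, where $$\sum_{j}\beta_k(j)u^j=O_k(u)\left(\frac{1-u^{k+1}}{1-u}\right)^{n-k},\qquad O_k(u)=\sum_{j=0}^{k}C_{k-j,k}(u^{k+1})\,(u^{k+1}-1)^j\sum_{i=j}^{k}\binom{i}{j}u^{-i},$$ as formal Laurent series in $u$ over $K$, and $\beta_k((k+1)d)=0$ for every integer $d<0$. -/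

import Mathlib

open Polynomial
open scoped LaurentSeries

/-- The Coxeter group `B_n` of signed permutations: the bijections `π` of the integer interval
`[-n, n]` onto itself such that `π (-i) = -π i`. -/
abbrev SignedPerm (n : ℕ) : Type :=
  {π : Equiv.Perm {i : ℤ // i ∈ Finset.Icc (-(n : ℤ)) (n : ℤ)} //
    ∀ i j : {i : ℤ // i ∈ Finset.Icc (-(n : ℤ)) (n : ℤ)},
      (j : ℤ) = -(i : ℤ) → (π j : ℤ) = -(π i : ℤ)}

namespace SignedPerm

/-- The integer `π i` for `i` in `[-n, n]` (and `0`, never used, for other `i`). -/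
noncomputable def val {n : ℕ} (π : SignedPerm n) (i : ℤ) : ℤ :=
  if h : i ∈ Finset.Icc (-(n : ℤ)) (n : ℤ) then (π.1 ⟨i, h⟩ : ℤ) else 0

/-- The type B descent number: the number of `i ∈ [0, n-1]` with `π i > π (i + 1)`. -/
noncomputable def des {n : ℕ} (π : SignedPerm n) : ℕ :=
  ((Finset.range n).filter fun i : ℕ => π.val (i : ℤ) > π.val ((i : ℤ) + 1)).card

/-- The type B maximum drop: the maximum of the drop sizes `min (i - π i) i` over the positions
`i ∈ [1, n]` with a drop, that is with `π i < i` (and `0` if there is no drop). -/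
noncomputable def maxDrop {n : ℕ} (π : SignedPerm n) : ℕ :=
  ((Finset.Icc 1 n).filter fun i : ℕ => π.val (i : ℤ) < (i : ℤ)).sup
    fun i : ℕ => (min ((i : ℤ) - π.val (i : ℤ)) (i : ℤ)).toNat

end SignedPerm

/-- The type B Eulerian polynomial `B_n(x)`: the sum of `x ^ des π` over all `π ∈ B_n`. -/
noncomputable def eulerianB (n : ℕ) : ℚ[X] :=
  ∑ π : SignedPerm n, X ^ π.des

/-- The restricted descent polynomial `B_{n,k}(x)`: the sum of `x ^ des π` over the `π ∈ B_n`
whose type B maximum drop is at most `k`. -/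
noncomputable def descPolyB (n k : ℕ) : ℚ[X] :=
  ∑ π ∈ Finset.univ.filter (fun π : SignedPerm n => π.maxDrop ≤ k), X ^ π.des

section LaurentFormulas

variable {K : Type*} [Field K]

/-- The variable `u` of the field `K((u))` of formal Laurent series. -/
noncomputable def uVar (K : Type*) [Field K] : K⸨X⸩ := HahnSeries.single 1 1

/-- For polynomials `C_0, …, C_k`, the Laurent polynomial
`∑_{j=0}^{k} C_{k-j}(u^{k+1}) (u^{k+1} - 1)^j ∑_{i=j}^{k} (i choose j) u^{-i}`. -/
noncomputable def kernelSeries (k : ℕ) (C : ℕ → K[X]) : K⸨X⸩ :=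
  ∑ j ∈ Finset.range (k + 1),
    aeval (uVar K ^ (k + 1)) (C (k - j)) * (uVar K ^ (k + 1) - 1) ^ j *
      ∑ i ∈ Finset.Icc j k, (Nat.choose i j : K⸨X⸩) * uVar K ^ (-(i : ℤ))

/-- The Laurent series `P(u) ((1 - u^{k+1}) / (1 - u))^{n-k}`, the exponent being an integer. -/
noncomputable def expandSeries (n k : ℕ) (P : K⸨X⸩) : K⸨X⸩ :=
  P * ((1 - uVar K ^ (k + 1)) / (1 - uVar K)) ^ ((n : ℤ) - (k : ℤ))

end LaurentFormulas

/-- `Q_k(u) = ∑_{j=0}^{k} B_{k-j}(u^{k+1}) (u^{k+1} - 1)^j ∑_{i=j}^{k} (i choose j) u^{-i}`. -/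
noncomputable def qSeries (k : ℕ) : ℚ⸨X⸩ := kernelSeries k eulerianB

/-- The coefficient `γ_k(j)` of `u^j` in `Q_k(u) ((1 - u^{k+1}) / (1 - u))^{n-k}`. -/
noncomputable def gammaCoeff (n k : ℕ) (j : ℤ) : ℚ := (expandSeries n k (qSeries k)).coeff j

/-! Combinatorial half: among signed permutations of size n+1 with n ≥ k, maximum drop at most k
forces the last letter v to be at least n+1-k ≥ 1. Deleting it leaves an arbitrary element of size n
with the same bound. Lowering v+1 to v creates a descent exactly when the preceding letter becomes v
after renaming (`lastDescPolyB_step`). Iterating and summing over v gives `descPolyB_recurrence`,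
the recurrence of part (b); for n ≤ k the drop bound is vacuous. Algebraic half: extracting every
(k+1)-st coefficient turns multiplication by p(u^{k+1}) into multiplication by p(u). With g =
(1-u^{k+1})/(1-u), the identity (u^{k+1}-1) + g = ug makes the powers of g satisfy the recurrence at
x = u^{k+1} (`geomSeries_pow_succ`). This leaves n ≤ k, where the kernel is built so that the
section of (u-1)^{k-n} times it is (u-1)^{k-n} C_n(u); the factors (u^{k+1}-1)^{k-n} and (u-1)^{k-n}
then cancel (`isSection_expandSeries_of_le`). -/

namespace SignedPerm

/-! ### Signed permutations and appending a last letter -/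

variable {n : ℕ}

lemma val_of_mem (π : SignedPerm n) {i : ℤ} (h : i ∈ Finset.Icc (-(n : ℤ)) n) :
    π.val i = (π.1 ⟨i, h⟩ : ℤ) := dif_pos h

lemma val_of_notMem (π : SignedPerm n) {i : ℤ} (h : i ∉ Finset.Icc (-(n : ℤ)) n) :
    π.val i = 0 := dif_neg h

lemma val_mem (π : SignedPerm n) {i : ℤ} (h : i ∈ Finset.Icc (-(n : ℤ)) n) :
    π.val i ∈ Finset.Icc (-(n : ℤ)) n := by
  rw [val_of_mem π h]
  exact (π.1 ⟨i, h⟩).2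

lemma val_neg (π : SignedPerm n) (i : ℤ) : π.val (-i) = -π.val i := by
  by_cases h : i ∈ Finset.Icc (-(n : ℤ)) n
  · have h' : -i ∈ Finset.Icc (-(n : ℤ)) n := by
      simp only [Finset.mem_Icc] at h ⊢
      omega
    rw [val_of_mem π h, val_of_mem π h']
    exact π.2 ⟨i, h⟩ ⟨-i, h'⟩ rfl
  · have h' : -i ∉ Finset.Icc (-(n : ℤ)) n := by
      simp only [Finset.mem_Icc] at h ⊢
      omega
    rw [val_of_notMem π h, val_of_notMem π h', neg_zero]

lemma val_inj (π : SignedPerm n) {i j : ℤ} (hi : i ∈ Finset.Icc (-(n : ℤ)) n)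
    (hj : j ∈ Finset.Icc (-(n : ℤ)) n) (h : π.val i = π.val j) : i = j := by
  rw [val_of_mem π hi, val_of_mem π hj] at h
  exact congrArg Subtype.val (π.1.injective (Subtype.ext h))

lemma ext_val {π σ : SignedPerm n}
    (h : ∀ i ∈ Finset.Icc (-(n : ℤ)) n, π.val i = σ.val i) : π = σ := by
  apply Subtype.ext
  ext ⟨i, hi⟩
  have := h i hi
  rwa [val_of_mem π hi, val_of_mem σ hi] at this

/-- The signed permutation given by an odd function that is injective on `[-n, n]`. -/
noncomputable def ofFun (f : ℤ → ℤ)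
    (hmem : ∀ i ∈ Finset.Icc (-(n : ℤ)) n, f i ∈ Finset.Icc (-(n : ℤ)) n)
    (hinj : ∀ i ∈ Finset.Icc (-(n : ℤ)) n, ∀ j ∈ Finset.Icc (-(n : ℤ)) n, f i = f j → i = j)
    (hneg : ∀ i, f (-i) = -f i) : SignedPerm n :=
  ⟨Equiv.ofBijective (fun i => ⟨f i, hmem i i.2⟩) (Finite.injective_iff_bijective.1 fun i j h =>
    Subtype.ext (hinj i i.2 j j.2 (congrArg Subtype.val h))), fun i j h => by
      simp [h, hneg]⟩

lemma val_ofFun (f : ℤ → ℤ) (hmem hinj hneg) {i : ℤ} (hi : i ∈ Finset.Icc (-(n : ℤ)) n) :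
    (ofFun (n := n) f hmem hinj hneg).val i = f i := by
  rw [val_of_mem _ hi]
  rfl

/-- A drop at position i has size at most i, so positions i ≤ k impose nothing. -/
lemma maxDrop_le_iff (π : SignedPerm n) (k : ℕ) :
    π.maxDrop ≤ k ↔ ∀ i : ℕ, k < i → i ≤ n → (i : ℤ) - k ≤ π.val i := by
  simp only [maxDrop, Finset.sup_le_iff, Finset.mem_filter, Finset.mem_Icc]
  constructor
  · intro h i hk hn
    by_cases hi : π.val i < i
    · have := h i ⟨⟨by omega, hn⟩, hi⟩
      omega
    · omega
  · rintro h i ⟨⟨h1, hn⟩, hi⟩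
    by_cases hk : k < i
    · have := h i hk hn
      omega
    · omega

/-- The increasing odd function with values in the integers other than `v` and `-v`. -/
def gap (v t : ℤ) : ℤ := if v ≤ t then t + 1 else if t ≤ -v then t - 1 else t

/-- The inverse of `gap v` on the integers other than `v` and `-v`. -/
def ungap (v t : ℤ) : ℤ := if v < t then t - 1 else if t < -v then t + 1 else t

/-- The signed permutation obtained by appending the letter `v` and renaming the others. -/
noncomputable def append (π : SignedPerm n) (v : ℤ) (h1 : 1 ≤ v) (hv : v ≤ n + 1) :
    SignedPerm (n + 1) :=
  ofFun (fun i => if i = n + 1 then v else if i = -(n + 1) then -v else gap v (π.val i))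
    (by
      intro i hi
      have hm := fun h => Finset.mem_Icc.1 (π.val_mem (i := i) h)
      simp only [Finset.mem_Icc, gap] at hi hm ⊢
      push_cast at hi ⊢
      by_cases h : -(n : ℤ) ≤ i ∧ i ≤ n
      · have := hm h
        split_ifs <;> omega
      · split_ifs <;> omega)
    (by
      intro i hi j hj h
      have hm := fun hi hj => π.val_inj (i := i) (j := j) hi hj
      simp only [Finset.mem_Icc, gap] at hi hj h hm
      push_cast at hi hj
      by_cases h' : (-(n : ℤ) ≤ i ∧ i ≤ n) ∧ (-(n : ℤ) ≤ j ∧ j ≤ n)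
      · apply hm h'.1 h'.2
        split_ifs at h <;> omega
      · split_ifs at h <;> omega)
    (by
      intro i
      have := π.val_neg i
      simp only [gap, this]
      split_ifs <;> omega)

lemma val_append (π : SignedPerm n) {v : ℤ} (h1 : 1 ≤ v) (hv : v ≤ n + 1) {i : ℤ}
    (hi : i ∈ Finset.Icc (-(n : ℤ)) n) : (π.append v h1 hv).val i = gap v (π.val i) := by
  simp only [Finset.mem_Icc] at hi
  rw [append, val_ofFun, if_neg (by omega), if_neg (by omega)]
  simp only [Finset.mem_Icc]
  omega

lemma val_append_last (π : SignedPerm n) {v : ℤ} (h1 : 1 ≤ v) (hv : v ≤ n + 1) :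
    (π.append v h1 hv).val (n + 1) = v := by
  rw [append, val_ofFun, if_pos rfl]
  simp only [Finset.mem_Icc]
  omega

/-- `gap v` is strictly increasing, so the old descents persist and only position n can add one. -/
lemma des_append (π : SignedPerm n) {v : ℤ} (h1 : 1 ≤ v) (hv : v ≤ n + 1) :
    (π.append v h1 hv).des = π.des + if v ≤ π.val n then 1 else 0 := by
  have hlast : (π.append v h1 hv).val n = gap v (π.val n) :=
    π.val_append h1 hv (by simp only [Finset.mem_Icc]; omega)
  have hinit : (Finset.range n).filter (fun i : ℕ =>
      (π.append v h1 hv).val i > (π.append v h1 hv).val (i + 1)) =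
      (Finset.range n).filter fun i : ℕ => π.val i > π.val (i + 1) := by
    refine Finset.filter_congr fun i hi => ?_
    rw [Finset.mem_range] at hi
    rw [val_append π h1 hv (by simp only [Finset.mem_Icc]; omega),
      val_append π h1 hv (by simp only [Finset.mem_Icc]; omega)]
    simp only [gap]
    split_ifs <;> omega
  rw [des, des, Finset.range_add_one, Finset.filter_insert, hinit, hlast, val_append_last]
  have : gap v (π.val n) > v ↔ v ≤ π.val n := by
    simp only [gap]
    split_ifs <;> omega
  simp only [this]
  split_ifs
  · rw [Finset.card_insert_of_notMem (by simp)]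
  · rfl

/-- For k < i ≤ n the threshold i-k lies strictly between 0 and v, and `gap v` moves no value across
it. -/
lemma maxDrop_append_le_iff (π : SignedPerm n) {v : ℤ} (h1 : 1 ≤ v) (hv : v ≤ n + 1) {k : ℕ}
    (hk : (n : ℤ) + 1 - k ≤ v) : (π.append v h1 hv).maxDrop ≤ k ↔ π.maxDrop ≤ k := by
  rw [maxDrop_le_iff, maxDrop_le_iff]
  constructor
  · intro h i hki hin
    have := h i hki (by omega)
    rw [val_append π h1 hv (by simp only [Finset.mem_Icc]; omega)] at this
    simp only [gap] at this
    split_ifs at this <;> omega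
  · intro h i hki hin
    obtain hin | rfl : i ≤ n ∨ i = n + 1 := by omega
    · have := h i hki hin
      rw [val_append π h1 hv (by simp only [Finset.mem_Icc]; omega)]
      simp only [gap]
      split_ifs <;> omega
    · push_cast
      rw [val_append_last]
      exact hk

lemma append_injective {v : ℤ} (h1 : 1 ≤ v) (hv : v ≤ n + 1) :
    Function.Injective fun π : SignedPerm n => π.append v h1 hv := by
  intro π σ h
  refine ext_val fun i hi => ?_
  have := congrArg (fun τ => val τ i) h
  simp only [val_append _ h1 hv hi, gap] at this
  split_ifs at this <;> omega

lemma exists_append_eq (σ : SignedPerm (n + 1)) {v : ℤ} (h1 : 1 ≤ v) (hv : v ≤ n + 1)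
    (hσ : σ.val (n + 1) = v) : ∃ π : SignedPerm n, π.append v h1 hv = σ := by
  have hσ' : σ.val (-(n + 1)) = -v := by rw [val_neg, hσ]
  have hmem : ∀ i : ℤ, -(n : ℤ) ≤ i → i ≤ n →
      -((n : ℤ) + 1) ≤ σ.val i ∧ σ.val i ≤ n + 1 ∧ σ.val i ≠ v ∧ σ.val i ≠ -v := by
    intro i hi hi'
    have h := σ.val_mem (i := i) (by simp only [Finset.mem_Icc]; omega)
    simp only [Finset.mem_Icc] at h
    push_cast at h
    refine ⟨h.1, h.2, fun h => ?_, fun h => ?_⟩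
    · have := σ.val_inj (i := i) (j := n + 1) (by simp only [Finset.mem_Icc]; omega)
        (by simp only [Finset.mem_Icc]; omega) (by rw [h, hσ])
      omega
    · have := σ.val_inj (i := i) (j := -(n + 1)) (by simp only [Finset.mem_Icc]; omega)
        (by simp only [Finset.mem_Icc]; omega) (by rw [h, hσ'])
      omega
  refine ⟨ofFun (fun i => ungap v (σ.val i)) ?_ ?_ ?_, ext_val fun i hi => ?_⟩
  · intro i hi
    simp only [Finset.mem_Icc, ungap] at hi ⊢
    have := hmem i hi.1 hi.2
    split_ifs <;> omega
  · intro i hi j hj h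
    simp only [Finset.mem_Icc, ungap] at hi hj h
    have h2 := hmem i hi.1 hi.2
    have h3 := hmem j hj.1 hj.2
    refine σ.val_inj (by simp only [Finset.mem_Icc]; omega)
      (by simp only [Finset.mem_Icc]; omega) ?_
    split_ifs at h <;> omega
  · intro i
    simp only [ungap, val_neg]
    split_ifs <;> omega
  · simp only [Finset.mem_Icc] at hi
    push_cast at hi
    obtain rfl | rfl | hi : i = n + 1 ∨ i = -(n + 1) ∨ (-(n : ℤ) ≤ i ∧ i ≤ n) := by omega
    · rw [val_append_last, hσ]
    · rw [val_neg, val_append_last, hσ']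
    · have h2 := hmem i hi.1 hi.2
      rw [val_append _ h1 hv (Finset.mem_Icc.2 hi), val_ofFun _ _ _ _ (Finset.mem_Icc.2 hi)]
      simp only [gap, ungap]
      split_ifs <;> omega

end SignedPerm

/-! ### The recurrence for the restricted descent polynomials -/

open SignedPerm

/-- The part of `descPolyB n k` that comes from the `π` with last value `π n = v`. -/
noncomputable def lastDescPolyB (n k : ℕ) (v : ℤ) : ℚ[X] :=
  ∑ π ∈ Finset.univ.filter (fun π : SignedPerm n => π.maxDrop ≤ k) with π.val n = v, X ^ π.des

lemma lastDescPolyB_succ_eq_sum {n k : ℕ} {v : ℤ} (h1 : 1 ≤ v) (hv : v ≤ n + 1)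
    (hk : (n : ℤ) + 1 - k ≤ v) : lastDescPolyB (n + 1) k v =
      ∑ π ∈ Finset.univ.filter (fun π : SignedPerm n => π.maxDrop ≤ k),
        X ^ (π.des + if v ≤ π.val n then 1 else 0) := by
  symm
  refine Finset.sum_bij (fun π _ => π.append v h1 hv) ?_ ?_ ?_ ?_
  · intro π hπ
    simp only [Finset.mem_filter, Finset.mem_univ, true_and, maxDrop_append_le_iff π h1 hv hk]
      at hπ ⊢
    exact ⟨hπ, by push_cast; exact π.val_append_last h1 hv⟩
  · exact fun π _ σ _ h => append_injective h1 hv h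
  · intro σ hσ
    simp only [Finset.mem_filter, Finset.mem_univ, true_and] at hσ
    push_cast at hσ
    obtain ⟨π, rfl⟩ := σ.exists_append_eq h1 hv hσ.2
    exact ⟨π, by simpa [maxDrop_append_le_iff π h1 hv hk] using hσ.1, rfl⟩
  · intro π _
    rw [des_append]

lemma lastDescPolyB_top (n k : ℕ) : lastDescPolyB (n + 1) k (n + 1) = descPolyB n k := by
  rw [lastDescPolyB_succ_eq_sum (by omega) le_rfl (by omega), descPolyB]
  refine Finset.sum_congr rfl fun π _ => ?_
  have := Finset.mem_Icc.1 (π.val_mem (i := n) (by simp only [Finset.mem_Icc]; omega))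
  rw [if_neg (by omega), add_zero]

/-- Appending v or v+1 to the same π gives different descent numbers only if π(n) = v, where v
yields one more. -/
lemma lastDescPolyB_step {n k : ℕ} {v : ℤ} (h1 : 1 ≤ v) (hv : v ≤ n)
    (hk : (n : ℤ) + 1 - k ≤ v) : lastDescPolyB (n + 1) k v =
      lastDescPolyB (n + 1) k (v + 1) + (X - 1) * lastDescPolyB n k v := by
  rw [lastDescPolyB_succ_eq_sum h1 (by omega) hk,
    lastDescPolyB_succ_eq_sum (by omega) (by omega) (by omega), lastDescPolyB,
    Finset.sum_filter (fun π : SignedPerm n => π.val n = v), Finset.mul_sum,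
    ← Finset.sum_add_distrib]
  refine Finset.sum_congr rfl fun π _ => ?_
  obtain h | h | h := lt_trichotomy (π.val n) v
  · rw [if_neg (by omega), if_neg (by omega), if_neg (by omega), mul_zero, add_zero, add_zero]
  · rw [if_pos (by omega), if_neg (by omega), if_pos (by omega)]
    ring
  · rw [if_pos (by omega), if_pos (by omega), if_neg (by omega), mul_zero, add_zero]

lemma sum_choose_add_mul_sum_choose {R : Type*} [CommRing R] (y : R) (b : ℕ → R) (i : ℕ) :
    ∑ l ∈ Finset.range (i + 1), (i.choose l : R) * y ^ l * b l +
        y * ∑ l ∈ Finset.range (i + 1), (i.choose l : R) * y ^ l * b (l + 1) =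
      ∑ l ∈ Finset.range (i + 1 + 1), ((i + 1).choose l : R) * y ^ l * b l := by
  have h := Finset.sum_range_succ' (fun l => (i.choose l : R) * y ^ l * b l) (i + 1)
  rw [Finset.sum_range_succ, Nat.choose_succ_self, Nat.cast_zero, zero_mul, zero_mul,
    add_zero] at h
  rw [h, Finset.sum_range_succ' _ (i + 1), Finset.mul_sum, add_right_comm,
    ← Finset.sum_add_distrib, Nat.choose_zero_right, Nat.choose_zero_right]
  congr 1
  refine Finset.sum_congr rfl fun l _ => ?_
  rw [Nat.choose_succ_succ, Nat.cast_add]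
  ring

lemma lastDescPolyB_eq_sum_choose {i n k : ℕ} (hn : i ≤ n) (hk : i ≤ k) :
    lastDescPolyB (n + 1) k (n + 1 - i) =
      ∑ l ∈ Finset.range (i + 1), (i.choose l : ℚ[X]) * (X - 1) ^ l * descPolyB (n - l) k := by
  induction i generalizing n with
  | zero => simp [lastDescPolyB_top]
  | succ i ih =>
    obtain ⟨m, rfl⟩ : ∃ m, n = m + 1 := ⟨n - 1, by omega⟩
    have e1 : ((m + 1 : ℕ) : ℤ) + 1 - (i + 1 : ℕ) + 1 = ((m + 1 : ℕ) : ℤ) + 1 - i := by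
      push_cast; ring
    have e2 : ((m + 1 : ℕ) : ℤ) + 1 - (i + 1 : ℕ) = (m : ℤ) + 1 - i := by push_cast; ring
    rw [lastDescPolyB_step (by omega) (by omega) (by omega), e1, e2,
      ih (by omega) (by omega), ih (by omega) (by omega),
      ← sum_choose_add_mul_sum_choose (X - 1) (fun l => descPolyB (m + 1 - l) k) i]
    simp only [Nat.add_sub_add_right]

lemma descPolyB_succ_eq_sum_last {n k : ℕ} (h : k ≤ n) : descPolyB (n + 1) k =
    ∑ i ∈ Finset.range (k + 1), lastDescPolyB (n + 1) k (n + 1 - i) := by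
  have hb : ∀ π : SignedPerm (n + 1), π.maxDrop ≤ k →
      (n : ℤ) + 1 - k ≤ π.val (n + 1 : ℕ) ∧ π.val (n + 1 : ℕ) ≤ n + 1 := by
    intro π hπ
    have h2 := (π.maxDrop_le_iff k).1 hπ (n + 1) (by omega) le_rfl
    have h3 := Finset.mem_Icc.1 (π.val_mem (i := (n + 1 : ℕ)) (by simp only [Finset.mem_Icc]; omega))
    omega
  rw [descPolyB, ← Finset.sum_fiberwise_of_maps_to
    (g := fun π : SignedPerm (n + 1) => ((n : ℤ) + 1 - π.val (n + 1 : ℕ)).toNat)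
    (t := Finset.range (k + 1))]
  · refine Finset.sum_congr rfl fun i _ => ?_
    rw [lastDescPolyB]
    refine Finset.sum_congr (Finset.filter_congr fun π hπ => ?_) fun _ _ => rfl
    have := hb π (Finset.mem_filter.1 hπ).2
    omega
  · intro π hπ
    have := hb π (Finset.mem_filter.1 hπ).2
    rw [Finset.mem_range]
    omega

lemma descPolyB_recurrence (n k : ℕ) : descPolyB (n + k + 1) k =
    ∑ i ∈ Finset.Icc 1 (k + 1),
      (Nat.choose (k + 1) i : ℚ[X]) * (X - 1) ^ (i - 1) * descPolyB (n + k + 1 - i) k := by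
  rw [descPolyB_succ_eq_sum_last (by omega)]
  have h : ∀ i ∈ Finset.range (k + 1), lastDescPolyB (n + k + 1) k ((n + k : ℕ) + 1 - i) =
      ∑ l ∈ Finset.range (k + 1), (i.choose l : ℚ[X]) * ((X - 1) ^ l * descPolyB (n + k - l) k) := by
    intro i hi
    rw [Finset.mem_range] at hi
    rw [lastDescPolyB_eq_sum_choose (by omega) (by omega)]
    simp only [mul_assoc]
    refine Finset.sum_subset (Finset.range_mono (by omega)) fun l _ hl => ?_
    rw [Finset.mem_range] at hl
    rw [Nat.choose_eq_zero_of_lt (by omega), Nat.cast_zero, zero_mul]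
  rw [Finset.sum_congr rfl h, Finset.sum_comm, ← Finset.Ico_add_one_right_eq_Icc,
    Finset.sum_Ico_eq_sum_range]
  refine Finset.sum_congr rfl fun l _ => ?_
  -- Summing over the last letter collects binomials along a column; l+1 is the index i of the
  -- recurrence.
  have hockey : ∀ m : ℕ, ∑ x ∈ Finset.range m, x.choose l = m.choose (l + 1) := by
    intro m
    induction m with
    | zero => rfl
    | succ m ih => rw [Finset.sum_range_succ, ih, Nat.choose_succ_succ, add_comm]
  rw [← Finset.sum_mul, ← Nat.cast_sum, hockey, mul_assoc, add_comm 1 l, Nat.add_sub_cancel,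
    Nat.add_sub_add_right]

lemma descPolyB_eq_eulerianB {n k : ℕ} (h : n ≤ k) : descPolyB n k = eulerianB n := by
  rw [descPolyB, eulerianB, Finset.filter_true_of_mem]
  intro π _
  rw [maxDrop_le_iff]
  intro i
  omega

/-! ### Extracting every (k+1)-st coefficient -/

section Sections

variable {K : Type*} [Field K] {k : ℕ}

lemma algebraMap_laurentSeries_eq_C (a : K) : algebraMap K K⸨X⸩ a = HahnSeries.C a :=
  (HahnSeries.algebraMap_apply' ℤ a).trans (HahnSeries.ofPowerSeries_C a)

lemma coeff_algebraMap_mul (a : K) (f : K⸨X⸩) (d : ℤ) :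
    (algebraMap K K⸨X⸩ a * f).coeff d = a * f.coeff d := by
  rw [algebraMap_laurentSeries_eq_C, HahnSeries.C_apply, HahnSeries.coeff_single_mul, sub_zero]

/-- `g` consists of every `(k+1)`-st coefficient of `f`. -/
def IsSection (k : ℕ) (f g : K⸨X⸩) : Prop :=
  ∀ d : ℤ, f.coeff (((k : ℤ) + 1) * d) = g.coeff d

lemma uVar_ne_zero : uVar K ≠ 0 := HahnSeries.single_ne_zero one_ne_zero

lemma uVar_zpow (n : ℤ) : uVar K ^ n = HahnSeries.single n 1 := (RatFunc.single_zpow n).symm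

lemma uVar_pow (n : ℕ) : uVar K ^ n = HahnSeries.single (n : ℤ) 1 := by
  rw [← zpow_natCast, uVar_zpow]

lemma uVar_pow_succ_ne_one (k : ℕ) : uVar K ^ (k + 1) ≠ 1 := by
  intro h
  have := congrArg (fun f => HahnSeries.coeff f 0) h
  rw [uVar_pow] at this
  simp only [HahnSeries.coeff_one, if_true] at this
  rw [HahnSeries.coeff_single_of_ne (by omega)] at this
  exact zero_ne_one this

lemma uVar_ne_one : uVar K ≠ 1 := by
  simpa using uVar_pow_succ_ne_one (K := K) 0

namespace IsSection

lemma add {f g f' g' : K⸨X⸩} (h : IsSection k f g) (h' : IsSection k f' g') :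
    IsSection k (f + f') (g + g') := fun d => by
  rw [HahnSeries.coeff_add, HahnSeries.coeff_add, h, h']

lemma sum {ι : Type*} (s : Finset ι) {f g : ι → K⸨X⸩} (h : ∀ i ∈ s, IsSection k (f i) (g i)) :
    IsSection k (∑ i ∈ s, f i) (∑ i ∈ s, g i) := fun d => by
  rw [HahnSeries.coeff_sum, HahnSeries.coeff_sum]
  exact Finset.sum_congr rfl fun i hi => h i hi d

lemma C_mul {f g : K⸨X⸩} (a : K) (h : IsSection k f g) :
    IsSection k (algebraMap K K⸨X⸩ a * f) (algebraMap K K⸨X⸩ a * g) := fun d => by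
  rw [coeff_algebraMap_mul, coeff_algebraMap_mul, h]

lemma uVar_pow_mul {f g : K⸨X⸩} (h : IsSection k f g) :
    IsSection k (uVar K ^ (k + 1) * f) (uVar K * g) := fun d => by
  rw [uVar_pow, uVar, HahnSeries.coeff_single_mul, HahnSeries.coeff_single_mul, ← h]
  congr 2
  push_cast
  ring

lemma aeval_mul {f g : K⸨X⸩} (h : IsSection k f g) (p : K[X]) :
    IsSection k (aeval (uVar K ^ (k + 1)) p * f) (aeval (uVar K) p * g) := by
  induction p using Polynomial.induction_on' with
  | add p q hp hq =>
    rw [map_add, map_add, add_mul, add_mul]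
    exact hp.add hq
  | monomial n a =>
    rw [aeval_monomial, aeval_monomial, mul_assoc, mul_assoc]
    refine C_mul a ?_
    induction n with
    | zero => simpa using h
    | succ n ih =>
      rw [pow_succ' (uVar K ^ (k + 1)), pow_succ' (uVar K) n, mul_assoc, mul_assoc]
      exact ih.uVar_pow_mul

/-- The hypothesis makes the defect f_{(k+1)d} - g_d independent of d; it vanishes for very negative
d because Laurent series have finite order. -/
lemma of_sub_one_mul {f g : K⸨X⸩}
    (h : IsSection k ((uVar K ^ (k + 1) - 1) * f) ((uVar K - 1) * g)) : IsSection k f g := by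
  have step : ∀ d : ℤ, f.coeff (((k : ℤ) + 1) * (d - 1)) - g.coeff (d - 1) =
      f.coeff (((k : ℤ) + 1) * d) - g.coeff d := by
    intro d
    have := h d
    rw [sub_mul, sub_mul, one_mul, one_mul, HahnSeries.coeff_sub, HahnSeries.coeff_sub, uVar_pow,
      uVar, HahnSeries.coeff_single_mul, HahnSeries.coeff_single_mul,
      show ((k : ℤ) + 1) * d - (k + 1 : ℕ) = ((k : ℤ) + 1) * (d - 1) by push_cast; ring] at this
    linear_combination this
  have shift : ∀ (m : ℕ) (d : ℤ), f.coeff (((k : ℤ) + 1) * (d - m)) - g.coeff (d - m) =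
      f.coeff (((k : ℤ) + 1) * d) - g.coeff d := by
    intro m d
    induction m with
    | zero => simp
    | succ m ih =>
      rw [← ih, ← step (d - m)]
      push_cast
      rw [sub_sub]
  intro d
  -- The shifted index e is negative and below both orders, hence so is (k+1)e ≤ e.
  rw [← sub_eq_zero, ← shift (d.natAbs + f.order.natAbs + g.order.natAbs + 1) d]
  obtain ⟨e, he⟩ : ∃ e : ℤ, e = d - (d.natAbs + f.order.natAbs + g.order.natAbs + 1 : ℕ) :=
    ⟨_, rfl⟩
  have hf : e < f.order := by omega
  have hg : e < g.order := by omega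
  have h0 : e < 0 := by omega
  have hke : (k : ℤ) * e ≤ 0 := mul_nonpos_of_nonneg_of_nonpos (Int.natCast_nonneg k) h0.le
  rw [← he]
  rw [HahnSeries.coeff_eq_zero_of_lt_order (x := g) hg,
    HahnSeries.coeff_eq_zero_of_lt_order (x := f) (by linarith), sub_zero]

lemma of_sub_one_pow_mul (m : ℕ) {f g : K⸨X⸩}
    (h : IsSection k ((uVar K ^ (k + 1) - 1) ^ m * f) ((uVar K - 1) ^ m * g)) :
    IsSection k f g := by
  induction m with
  | zero => simpa using h
  | succ m ih =>
    rw [pow_succ' (uVar K ^ (k + 1) - 1), pow_succ' (uVar K - 1), mul_assoc, mul_assoc] at h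
    exact ih h.of_sub_one_mul

end IsSection

/-- Compare coefficients of X^j in X^m = ((X+1)-1)^m. -/
lemma sum_choose_mul_neg_one_pow_mul_choose (R : Type*) [CommRing R] (m j : ℕ) :
    ∑ l ∈ Finset.range (m + 1), (-1 : R) ^ (m - l) * (m.choose l : R) * (l.choose j : R) =
      if j = m then 1 else 0 := by
  have h := congrArg (fun p => Polynomial.coeff p j) (add_pow (X + 1 : R[X]) (-1) m)
  simp only [add_neg_cancel_right, coeff_X_pow, finsetSum_coeff] at h
  rw [h]
  refine Finset.sum_congr rfl fun l _ => ?_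
  rw [← coeff_X_add_one_pow R l j, ← coeff_C_mul]
  congr 1
  simp only [map_mul, map_pow, map_neg, map_one, map_natCast]
  ring

/-- Expanding gives exponents l-i with 0 ≤ l ≤ m ≤ k and 0 ≤ i ≤ k. The only multiple of k+1 among
them is 0, at i = l, and binomial inversion evaluates what remains. -/
lemma isSection_sub_one_pow_mul_sum {m j : ℕ} (hm : m ≤ k) :
    IsSection k ((uVar K - 1) ^ m *
      ∑ i ∈ Finset.Icc j k, (Nat.choose i j : K⸨X⸩) * uVar K ^ (-(i : ℤ)))
      (if j = m then 1 else 0) := by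
  intro d
  have hsum : ∑ i ∈ Finset.Icc j k, (Nat.choose i j : K⸨X⸩) * uVar K ^ (-(i : ℤ)) =
      ∑ i ∈ Finset.range (k + 1), (Nat.choose i j : K⸨X⸩) * uVar K ^ (-(i : ℤ)) := by
    refine Finset.sum_subset (fun i hi => ?_) fun i hi hi' => ?_
    · rw [Finset.mem_Icc] at hi
      rw [Finset.mem_range]
      omega
    · rw [Finset.mem_Icc] at hi'
      rw [Finset.mem_range] at hi
      rw [Nat.choose_eq_zero_of_lt (by omega), Nat.cast_zero, zero_mul]
  have hterm : ∀ l ∈ Finset.range (m + 1),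
      (uVar K ^ l * (-1) ^ (m - l) * (m.choose l : K⸨X⸩) *
        ∑ i ∈ Finset.range (k + 1), (Nat.choose i j : K⸨X⸩) * uVar K ^ (-(i : ℤ))).coeff
          (((k : ℤ) + 1) * d) =
      if d = 0 then (-1 : K) ^ (m - l) * (m.choose l : K) * (l.choose j : K) else 0 := by
    intro l hl
    rw [Finset.mem_range] at hl
    have hmono : ∀ i ∈ Finset.range (k + 1), uVar K ^ l * (-1) ^ (m - l) * (m.choose l : K⸨X⸩) *
        ((Nat.choose i j : K⸨X⸩) * uVar K ^ (-(i : ℤ))) =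
        algebraMap K K⸨X⸩ ((-1 : K) ^ (m - l) * (m.choose l : K) * (i.choose j : K)) *
          HahnSeries.single ((l : ℤ) - i) 1 := by
      intro i _
      rw [← uVar_zpow, sub_eq_add_neg, zpow_add₀ uVar_ne_zero, zpow_natCast]
      simp only [map_mul, map_pow, map_neg, map_one, map_natCast]
      ring
    rw [Finset.mul_sum, Finset.sum_congr rfl hmono, HahnSeries.coeff_sum]
    simp only [coeff_algebraMap_mul]
    rw [Finset.sum_eq_single_of_mem l (Finset.mem_range.2 (by omega))]
    · have h0 : ((k : ℤ) + 1) * d = 0 ↔ d = 0 := by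
        rw [mul_eq_zero, or_iff_right (by omega)]
      simp only [HahnSeries.coeff_single, sub_self, h0, mul_ite, mul_one, mul_zero]
    · intro i hi hil
      rw [Finset.mem_range] at hi
      rw [HahnSeries.coeff_single_of_ne, mul_zero]
      intro h
      have := Int.eq_zero_of_abs_lt_dvd (Dvd.intro d h) (abs_lt.2 ⟨by omega, by omega⟩)
      omega
  rw [hsum, sub_eq_add_neg, add_pow, Finset.sum_mul, HahnSeries.coeff_sum,
    Finset.sum_congr rfl hterm]
  by_cases hd : d = 0
  · subst hd
    simp only [if_true]
    rw [sum_choose_mul_neg_one_pow_mul_choose]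
    split_ifs <;> simp
  · simp only [if_neg hd, Finset.sum_const_zero]
    split_ifs
    · simp [HahnSeries.coeff_one, hd]
    · rfl

/-! ### Powers of the geometric sum and the coefficient formula -/

/-- `(1 - u^{k+1}) / (1 - u)`. -/
noncomputable def geomSeries (K : Type*) [Field K] (k : ℕ) : K⸨X⸩ :=
  (1 - uVar K ^ (k + 1)) / (1 - uVar K)

lemma geomSeries_mul (k : ℕ) : geomSeries K k * (uVar K - 1) = uVar K ^ (k + 1) - 1 := by
  have h : 1 - uVar K ≠ 0 := sub_ne_zero.2 uVar_ne_one.symm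
  rw [geomSeries]
  field_simp
  ring

lemma geomSeries_ne_zero (k : ℕ) : geomSeries K k ≠ 0 :=
  left_ne_zero_of_mul (b := uVar K - 1) (by
    rw [geomSeries_mul]
    exact sub_ne_zero.2 (uVar_pow_succ_ne_one k))

lemma geomSeries_eq_sum (k : ℕ) :
    geomSeries K k = ∑ i ∈ Finset.range (k + 1), uVar K ^ i :=
  mul_right_cancel₀ (sub_ne_zero.2 uVar_ne_one) (by rw [geomSeries_mul, geom_sum_mul])

/-- Expand (ug)^{k+1} = ((u^{k+1}-1) + g)^{k+1}, move the term g^{k+1} to the left, and divide by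
u^{k+1}-1. -/
lemma geomSeries_pow_succ (k : ℕ) : geomSeries K k ^ (k + 1) =
    ∑ i ∈ Finset.Icc 1 (k + 1), (Nat.choose (k + 1) i : K⸨X⸩) * (uVar K ^ (k + 1) - 1) ^ (i - 1) *
      geomSeries K k ^ (k + 1 - i) := by
  have hx : uVar K ^ (k + 1) - 1 ≠ 0 := sub_ne_zero.2 (uVar_pow_succ_ne_one k)
  apply mul_left_cancel₀ hx
  have h := add_pow (uVar K ^ (k + 1) - 1) (geomSeries K k) (k + 1)
  rw [Finset.sum_range_succ', show uVar K ^ (k + 1) - 1 + geomSeries K k =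
    uVar K * geomSeries K k by linear_combination -geomSeries_mul (K := K) k, mul_pow] at h
  rw [← Finset.Ico_add_one_right_eq_Icc, Finset.sum_Ico_eq_sum_range, Finset.mul_sum]
  simp only [Nat.sub_zero, pow_zero, one_mul, Nat.choose_zero_right, Nat.cast_one, mul_one] at h
  rw [sub_mul, one_mul, h, add_sub_cancel_right]
  refine Finset.sum_congr rfl fun i _ => ?_
  rw [add_comm 1 i, Nat.add_sub_cancel]
  ring

lemma expandSeries_recurrence (n k : ℕ) (P : K⸨X⸩) : expandSeries (n + k + 1) k P =
    ∑ i ∈ Finset.Icc 1 (k + 1), aeval (uVar K ^ (k + 1))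
      ((Nat.choose (k + 1) i : K[X]) * (X - 1) ^ (i - 1)) * expandSeries (n + k + 1 - i) k P := by
  have hz : ∀ i ≤ k + 1, expandSeries (n + k + 1 - i) k P =
      P * geomSeries K k ^ ((n : ℤ) - k) * geomSeries K k ^ (k + 1 - i) := by
    intro i hi
    rw [expandSeries, ← geomSeries, mul_assoc, ← zpow_natCast, ← zpow_add₀ (geomSeries_ne_zero k)]
    congr 2
    omega
  rw [← Nat.sub_zero (n + k + 1), hz 0 (by omega), Nat.sub_zero, Nat.sub_zero, geomSeries_pow_succ,
    Finset.mul_sum]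
  refine Finset.sum_congr rfl fun i hi => ?_
  rw [hz i (Finset.mem_Icc.1 hi).2]
  simp only [map_mul, map_pow, map_sub, map_one, map_natCast, aeval_X]
  ring

/-- With m = k-n, multiplying by (u^{k+1}-1)^m clears g^{-m} and leaves (u-1)^m times the kernel,
whose section retains only the summand j = m. -/
lemma isSection_expandSeries_of_le (C : ℕ → K[X]) {n : ℕ} (hn : n ≤ k) :
    IsSection k (expandSeries n k (kernelSeries k C)) (aeval (uVar K) (C n)) := by
  obtain ⟨m, rfl⟩ : ∃ m, k = n + m := ⟨k - n, by omega⟩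
  apply IsSection.of_sub_one_pow_mul m
  have hz : (uVar K ^ (n + m + 1) - 1) ^ m * expandSeries n (n + m) (kernelSeries (n + m) C) =
      (uVar K - 1) ^ m * kernelSeries (n + m) C := by
    have := geomSeries_ne_zero (K := K) (n + m)
    rw [expandSeries, ← geomSeries, ← geomSeries_mul, mul_pow,
      show (n : ℤ) - (n + m : ℕ) = -(m : ℤ) by push_cast; ring, zpow_neg, zpow_natCast]
    field_simp
  have hs : IsSection (n + m)
      (∑ j ∈ Finset.range (n + m + 1),
        aeval (uVar K ^ (n + m + 1)) (C (n + m - j) * (X - 1) ^ j) * ((uVar K - 1) ^ m *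
          ∑ i ∈ Finset.Icc j (n + m), (Nat.choose i j : K⸨X⸩) * uVar K ^ (-(i : ℤ))))
      (∑ j ∈ Finset.range (n + m + 1),
        aeval (uVar K) (C (n + m - j) * (X - 1) ^ j) * (if j = m then 1 else 0)) :=
    IsSection.sum _ fun j _ => (isSection_sub_one_pow_mul_sum (by omega)).aeval_mul _
  rw [hz, kernelSeries, Finset.mul_sum]
  convert hs using 1
  · refine Finset.sum_congr rfl fun j _ => ?_
    simp only [map_mul, map_pow, map_sub, map_one, aeval_X]
    ring
  · simp only [mul_ite, mul_one, mul_zero, Finset.sum_ite_eq', Finset.mem_range]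
    rw [if_pos (by omega), Nat.add_sub_cancel]
    simp only [map_mul, map_pow, map_sub, map_one, aeval_X]
    ring

lemma isSection_expandSeries (C : ℕ → K[X])
    (hC : ∀ n : ℕ, C (n + k + 1) = ∑ i ∈ Finset.Icc 1 (k + 1),
      (Nat.choose (k + 1) i : K[X]) * (X - 1) ^ (i - 1) * C (n + k + 1 - i)) (n : ℕ) :
    IsSection k (expandSeries n k (kernelSeries k C)) (aeval (uVar K) (C n)) := by
  induction n using Nat.strong_induction_on with
  | _ n ih =>
    by_cases hn : n ≤ k
    · exact isSection_expandSeries_of_le C hn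
    · obtain ⟨m, rfl⟩ : ∃ m, n = m + k + 1 := ⟨n - k - 1, by omega⟩
      rw [expandSeries_recurrence, hC, map_sum]
      refine IsSection.sum _ fun i hi => ?_
      rw [Finset.mem_Icc] at hi
      rw [map_mul (aeval (uVar K))]
      exact (ih _ (by omega)).aeval_mul _

lemma aeval_uVar (p : K[X]) : aeval (uVar K) p = ((p : PowerSeries K) : K⸨X⸩) := by
  induction p using Polynomial.induction_on' with
  | add p q hp hq => rw [map_add, hp, hq, Polynomial.coe_add, PowerSeries.coe_add]
  | monomial n a =>
    rw [aeval_monomial, ← C_mul_X_pow_eq_monomial, Polynomial.coe_mul, Polynomial.coe_pow,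
      Polynomial.coe_C, Polynomial.coe_X, PowerSeries.coe_mul, PowerSeries.coe_pow,
      PowerSeries.coe_C, HahnSeries.ofPowerSeries_X, uVar,
      algebraMap_laurentSeries_eq_C]

lemma coe_eq_mk_and_coeff_eq_zero {f : K⸨X⸩} {p : K[X]}
    (h : IsSection k f (aeval (uVar K) p)) :
    (p : PowerSeries K) = PowerSeries.mk (fun d : ℕ => f.coeff (((k : ℤ) + 1) * (d : ℤ))) ∧
      ∀ d : ℤ, d < 0 → f.coeff (((k : ℤ) + 1) * d) = 0 := by
  refine ⟨PowerSeries.ext fun d => ?_, fun d hd => ?_⟩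
  · rw [PowerSeries.coeff_mk, h, aeval_uVar, LaurentSeries.coeff_coe_powerSeries]
  · rw [h, aeval_uVar, PowerSeries.coeff_coe, if_pos hd]

end Sections

lemma kernelSeries_congr {K : Type*} [Field K] {k : ℕ} {C D : ℕ → K[X]}
    (h : ∀ n ≤ k, C n = D n) : kernelSeries k C = kernelSeries k D := by
  refine Finset.sum_congr rfl fun j _ => ?_
  rw [h (k - j) (Nat.sub_le k j)]

theorem theorem4 :
    -- the explicit formula for `B_{n,k}(x)`
    (∀ n k : ℕ,
      (descPolyB n k : PowerSeries ℚ) =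
          PowerSeries.mk (fun d : ℕ => gammaCoeff n k (((k : ℤ) + 1) * (d : ℤ))) ∧
        (∀ d : ℤ, d < 0 → gammaCoeff n k (((k : ℤ) + 1) * d) = 0) ∧
        (∀ d : ℕ, (descPolyB n k).coeff d =
          (qSeries k * (∑ i ∈ Finset.range (k + 1), uVar ℚ ^ i) ^ ((n : ℤ) - (k : ℤ))).coeff
            (((k : ℤ) + 1) * (d : ℤ)))) ∧
    -- the general form, for an arbitrary solution of the recurrence
    (∀ (K : Type*) [Field K] (k : ℕ) (C : ℕ → Polynomial K),
      (∀ n : ℕ, C (n + k + 1) =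
        ∑ i ∈ Finset.Icc 1 (k + 1),
          (Nat.choose (k + 1) i : Polynomial K) * (Polynomial.X - 1) ^ (i - 1) *
            C (n + k + 1 - i)) →
      ∀ n : ℕ,
        (C n : PowerSeries K) =
            PowerSeries.mk (fun d : ℕ =>
              (expandSeries n k (kernelSeries k C)).coeff (((k : ℤ) + 1) * (d : ℤ))) ∧
          (∀ d : ℤ, d < 0 →
            (expandSeries n k (kernelSeries k C)).coeff (((k : ℤ) + 1) * d) = 0)) := by

  refine ⟨fun n k => ?_, fun K _ k C hC n =>
    coe_eq_mk_and_coeff_eq_zero (isSection_expandSeries C hC n)⟩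
  have hs := isSection_expandSeries (fun n => descPolyB n k)
    (fun n => descPolyB_recurrence n k) n
  -- The kernel involves only sizes at most k, where the drop bound is vacuous.
  rw [kernelSeries_congr fun n hn => descPolyB_eq_eulerianB hn, ← qSeries] at hs
  obtain ⟨h1, h2⟩ := coe_eq_mk_and_coeff_eq_zero hs
  refine ⟨h1, h2, fun d => ?_⟩
  rw [← Polynomial.coeff_coe, h1, PowerSeries.coeff_mk, expandSeries, ← geomSeries,
    geomSeries_eq_sum]
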